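/- Let $A$ be an associative ring with unit, not necessarily commutative; modules are left modules. Let $$\operatorname{FPD}(A)=\sup\{\operatorname{proj\,dim}_A(M)\mid M \text{ an } A\text{-module with } \operatorname{proj\,dim}_A(M)<\infty\},$$ $$\operatorname{FFD}(A)=\sup\{\operatorname{flat\,dim}_A(M)\mid M \text{ an } A\text{-module with } \operatorname{flat\,dim}_A(M)<\infty\}$$ be the big projective and the big flat finitistic dimension of $A$. Here $\operatorname{proj\,dim}_A(M)$ is the infimum of all $n$ such that $\operatorname{Ext}^i_A(M,N)=0$ for all $A$-modules $N$ and all $i>n$, and $\operatorname{flat\,dim}_A(M)$ is the infimum of all $n$ such that $\operatorname{Tor}_i^A(N,M)=0$ for all right $A$-modules $N$ and all $i>n$. Suppose that $\operatorname{FPD}(A)<\infty$ or $\operatorname{FFD}(A)<\infty$. Let $P$ be a cochain complex of projective $A$-modules (indexed by $\mathbb{Z}$, with differential of degree $+1$) that is acyclic and bounded below, i.e. $H^n(P)=0$ for all $n\in\mathbb{Z}$ and $P^n=0$ for all sufficiently small $n$. Then $P$ is null-homotopic, i.e. the identity map of $P$ is chain homotopic to zero. -/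

import Mathlib

open CategoryTheory

open scoped TensorProduct MulOpposite

universe u

noncomputable section

/-- The additive relations `(n · a) ⊗ m - n ⊗ (a · m)` inside `N ⊗_ℤ M`, for a right `A`-module `N`
(that is, a left module over the opposite ring) and a left `A`-module `M`. -/
def balancedRelations (A : Type u) [Ring A] (N M : Type u) [AddCommGroup N] [Module Aᵐᵒᵖ N]
    [AddCommGroup M] [Module A M] : Submodule ℤ (N ⊗[ℤ] M) :=
  Submodule.span ℤ
    {x | ∃ (n : N) (a : A) (m : M), x = (MulOpposite.op a • n) ⊗ₜ[ℤ] m - n ⊗ₜ[ℤ] (a • m)}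

/-- The tensor product `N ⊗_A M` (an abelian group) of a right module `N` and a left module `M`
over a ring `A` that need not be commutative. -/
abbrev BalancedTensor (A : Type u) [Ring A] (N M : Type u) [AddCommGroup N] [Module Aᵐᵒᵖ N]
    [AddCommGroup M] [Module A M] : Type u :=
  (N ⊗[ℤ] M) ⧸ balancedRelations A N M

theorem balancedRelations_le_comap (A : Type u) [Ring A] (N : Type u) [AddCommGroup N]
    [Module Aᵐᵒᵖ N] {M M' : Type u} [AddCommGroup M] [Module A M] [AddCommGroup M'] [Module A M']
    (f : M →ₗ[A] M') :
    balancedRelations A N M ≤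
      (balancedRelations A N M').comap (LinearMap.lTensor N f.toAddMonoidHom.toIntLinearMap) := by
  refine Submodule.span_le.2 ?_
  rintro _ ⟨n, a, m, rfl⟩
  refine Submodule.subset_span ⟨n, a, f m, ?_⟩
  simp

/-- The map `N ⊗_A M → N ⊗_A M'` induced by an `A`-linear map `f : M → M'`. -/
def BalancedTensor.map (A : Type u) [Ring A] (N : Type u) [AddCommGroup N]
    [Module Aᵐᵒᵖ N] {M M' : Type u} [AddCommGroup M] [Module A M] [AddCommGroup M'] [Module A M']
    (f : M →ₗ[A] M') : BalancedTensor A N M →ₗ[ℤ] BalancedTensor A N M' :=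
  Submodule.mapQ _ _ (LinearMap.lTensor N f.toAddMonoidHom.toIntLinearMap)
    (balancedRelations_le_comap A N f)

theorem BalancedTensor.map_id (A : Type u) [Ring A] (N : Type u) [AddCommGroup N]
    [Module Aᵐᵒᵖ N] (M : Type u) [AddCommGroup M] [Module A M] :
    BalancedTensor.map A N (LinearMap.id : M →ₗ[A] M) = LinearMap.id := by
  refine Submodule.linearMap_qext _ (TensorProduct.ext' fun n m => rfl)

theorem BalancedTensor.map_comp (A : Type u) [Ring A] (N : Type u) [AddCommGroup N]
    [Module Aᵐᵒᵖ N] {M M' M'' : Type u} [AddCommGroup M] [Module A M] [AddCommGroup M']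
    [Module A M'] [AddCommGroup M''] [Module A M''] (g : M' →ₗ[A] M'') (f : M →ₗ[A] M') :
    BalancedTensor.map A N (g.comp f) =
      (BalancedTensor.map A N g).comp (BalancedTensor.map A N f) := by
  refine Submodule.linearMap_qext _ (TensorProduct.ext' fun n m => rfl)

theorem BalancedTensor.map_add (A : Type u) [Ring A] (N : Type u) [AddCommGroup N]
    [Module Aᵐᵒᵖ N] {M M' : Type u} [AddCommGroup M] [Module A M] [AddCommGroup M']
    [Module A M'] (f g : M →ₗ[A] M') :
    BalancedTensor.map A N (f + g) = BalancedTensor.map A N f + BalancedTensor.map A N g := by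
  refine Submodule.linearMap_qext _ (TensorProduct.ext' fun n m => ?_)
  exact congrArg (Submodule.Quotient.mk (p := balancedRelations A N M'))
    (TensorProduct.tmul_add n (f m) (g m))

/-- The functor `N ⊗_A -` from left `A`-modules to abelian groups. -/
def balancedTensorFunctor (A : Type u) [Ring A] (N : ModuleCat.{u} Aᵐᵒᵖ) :
    ModuleCat.{u} A ⥤ ModuleCat.{u} ℤ where
  obj M := ModuleCat.of ℤ (BalancedTensor A N M)
  map f := ModuleCat.ofHom (BalancedTensor.map A N f.hom)
  map_id M := congrArg ModuleCat.ofHom (BalancedTensor.map_id A N M)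
  map_comp f g := congrArg ModuleCat.ofHom (BalancedTensor.map_comp A N g.hom f.hom)

instance balancedTensorFunctor_additive (A : Type u) [Ring A] (N : ModuleCat.{u} Aᵐᵒᵖ) :
    (balancedTensorFunctor A N).Additive where
  map_add {_ _ f g} := congrArg ModuleCat.ofHom (BalancedTensor.map_add A N f.hom g.hom)

/-- `Tor_i^A(N, M)`: the `i`-th left derived functor of `N ⊗_A -`, evaluated at `M`. -/
def ringTor (A : Type u) [Ring A] (i : ℕ) (N : ModuleCat.{u} Aᵐᵒᵖ) (M : ModuleCat.{u} A) :
    ModuleCat.{u} ℤ :=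
  ((balancedTensorFunctor A N).leftDerived i).obj M

/-- The flat dimension of a left `A`-module `M`: the infimum of those `n` for which
`Tor_i^A(N, M) = 0` for all right modules `N` and all `i > n`. As for
`CategoryTheory.projectiveDimension`, the value is `⊥` for the zero module, and `⊤` if
there is no finite bound. -/
def flatDimension (A : Type u) [Ring A] (M : ModuleCat.{u} A) : WithBot ℕ∞ :=
  sInf {n | ∀ i : ℕ, n < i → ∀ N : ModuleCat.{u} Aᵐᵒᵖ, Limits.IsZero (ringTor A i N M)}

/-- The big projective finitistic dimension `FPD(A)`. -/
def bigProjectiveFinitisticDim (A : Type u) [Ring A] : WithBot ℕ∞ :=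
  sSup {d | ∃ M : ModuleCat.{u} A, projectiveDimension M < ⊤ ∧ d = projectiveDimension M}

/-- The big flat finitistic dimension `FFD(A)`. -/
def bigFlatFinitisticDim (A : Type u) [Ring A] : WithBot ℕ∞ :=
  sSup {d | ∃ M : ModuleCat.{u} A, flatDimension A M < ⊤ ∧ d = flatDimension A M}

end

/-! Suppose first that FPD is finite. As P is bounded below, each cocycle module has a finite
coresolution by terms of P to its left, so it has finite projective dimension, and these dimensions
share one bound. Each cocycle module is also an arbitrarily high syzygy of a cocycle module further
right. Hence all of them are projective and P splits.

Suppose now that FFD is finite. The cokernels of the differentials have finite flat dimension, again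
with one bound. The cohomology of N ⊗ P at a given degree is a Tor of arbitrarily high index of a
cokernel further right, so N ⊗ P is acyclic for every right module N. Boundedness plays no further
role: a pure acyclic complex of projectives is contractible.

To see this, the grading is dropped and a swindle makes the module free on a set X
(`PureExact.exists_contraction`). Purity then gives the key fact `PureExact.exists_contraction_mem`:
every basis element lies in a subset of X, built as a countable union of finite sets, that spans a
contractible subcomplex. The quotient by a contractible coordinate subcomplex is again free and pure
exact (`IsContractionOn.pureExact_complDifferential`), and contractions extend across it
(`IsContractionOn.extend`). Zorn's lemma exhausts X, and the degree -1 part of the contraction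
contracts P. -/

/-! ### Purity of differential modules by linear equations -/

section PureExact

variable {A : Type u} [Ring A] {M M' : Type u} [AddCommGroup M] [Module A M]
  [AddCommGroup M'] [Module A M']

/-- A differential module `(M, d)` is pure exact if it stays exact after tensoring with every
finitely presented right module, phrased in terms of finite matrices over `A`. -/
def PureExact (d : M →ₗ[A] M) : Prop :=
  ∀ (σ τ : Type u) [Fintype σ] [Fintype τ] (a : σ → τ → A) (m : σ → M) (v : τ → M),
    (∀ s, d (m s) = ∑ t, a s t • v t) →
      ∃ (η : σ → M) (y : τ → M), ∀ s, m s = d (η s) + ∑ t, a s t • y t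

theorem PureExact.of_contraction {d : M →ₗ[A] M} (h : M →ₗ[A] M)
    (hh : ∀ x, h (d x) + d (h x) = x) : PureExact d := by
  intro σ τ _ _ a m v hm
  refine ⟨fun s => h (m s), fun t => h (v t), fun s => ?_⟩
  conv_lhs => rw [← hh (m s), hm s]
  simp [add_comm]

theorem PureExact.prod {d : M →ₗ[A] M} {d' : M' →ₗ[A] M'} (hd : PureExact d)
    (hd' : PureExact d') : PureExact (d.prodMap d') := by
  intro σ τ _ _ a m v hm
  obtain ⟨η, y, h⟩ := hd σ τ a (fun s => (m s).1) (fun t => (v t).1) fun s => by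
    simpa [Prod.fst_sum] using congrArg Prod.fst (hm s)
  obtain ⟨η', y', h'⟩ := hd' σ τ a (fun s => (m s).2) (fun t => (v t).2) fun s => by
    simpa [Prod.snd_sum] using congrArg Prod.snd (hm s)
  refine ⟨fun s => (η s, η' s), fun t => (y t, y' t), fun s => Prod.ext ?_ ?_⟩
  · simpa [Prod.fst_sum] using h s
  · simpa [Prod.snd_sum] using h' s

theorem PureExact.conj {d : M →ₗ[A] M} (hd : PureExact d) (e : M ≃ₗ[A] M') :
    PureExact (e.toLinearMap ∘ₗ d ∘ₗ e.symm.toLinearMap) := by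
  intro σ τ _ _ a m v hm
  obtain ⟨η, y, h⟩ := hd σ τ a (fun s => e.symm (m s)) (fun t => e.symm (v t)) fun s => by
    simpa using congrArg e.symm (hm s)
  refine ⟨fun s => e (η s), fun t => e (y t), fun s => ?_⟩
  simpa using congrArg e (h s)

end PureExact

/-! ### Linear maps on coordinate submodules -/

section Supported

variable {A : Type u} [Ring A] {X : Type u} {M : Type u} [AddCommGroup M] [Module A M]

theorem Finsupp.map_mem_of_mem_supported {f : (X →₀ A) →ₗ[A] M} {S : Set X} {N : Submodule A M}
    (hf : ∀ s ∈ S, f (Finsupp.single s 1) ∈ N) {x : X →₀ A} (hx : x ∈ Finsupp.supported A A S) :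
    f x ∈ N := by
  rw [Finsupp.supported_eq_span_single] at hx
  refine (Submodule.span_le (p := N.comap f)).2 ?_ hx
  rintro _ ⟨s, hs, rfl⟩
  exact hf s hs

theorem Finsupp.map_eq_of_mem_supported {f g : (X →₀ A) →ₗ[A] M} {S : Set X}
    (hf : ∀ s ∈ S, f (Finsupp.single s 1) = g (Finsupp.single s 1)) {x : X →₀ A}
    (hx : x ∈ Finsupp.supported A A S) : f x = g x := by
  have := Finsupp.map_mem_of_mem_supported (f := f - g) (N := ⊥) (S := S)
    (fun s hs => by simp [hf s hs]) hx
  simpa [sub_eq_zero] using this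

end Supported

/-! ### Contractions on coordinate subcomplexes: the countable step -/

section Contraction

variable {A : Type u} [Ring A] {X : Type u}

/-- `h` contracts the differential module `(X →₀ A, d)` on the submodule spanned by `Y`. -/
structure IsContractionOn (d : (X →₀ A) →ₗ[A] (X →₀ A)) (Y : Set X)
    (h : (X →₀ A) →ₗ[A] (X →₀ A)) : Prop where
  d_mem : ∀ x ∈ Finsupp.supported A A Y, d x ∈ Finsupp.supported A A Y
  h_mem : ∀ x ∈ Finsupp.supported A A Y, h x ∈ Finsupp.supported A A Y
  eq : ∀ x ∈ Finsupp.supported A A Y, h (d x) + d (h x) = x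

variable {d : (X →₀ A) →ₗ[A] (X →₀ A)}

/-- Purity is applied to the matrix of `d` itself, with rows in `S`, columns in the supports of the
`d s`, and the basis vectors as unknowns. The solution `η`, `y` is read as two linear maps `k`, `h`.
They need not agree, so this is only an approximate contraction. -/
theorem PureExact.exists_contraction_on_finset (hd : PureExact d) (x₀ : X) (S : Finset X) :
    ∃ (h k : (X →₀ A) →ₗ[A] (X →₀ A)) (S' : Finset X), S ⊆ S' ∧ x₀ ∈ S' ∧
      (∀ x ∈ Finsupp.supported A A (S : Set X), d x ∈ Finsupp.supported A A (S' : Set X)) ∧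
      (∀ x, h x ∈ Finsupp.supported A A (S' : Set X)) ∧
      (∀ x ∈ Finsupp.supported A A (S : Set X), k x ∈ Finsupp.supported A A (S' : Set X)) ∧
      (∀ x ∈ Finsupp.supported A A (S : Set X), h (d x) + d (k x) = x) := by
  classical
  set T : Finset X := S.biUnion fun s => (d (Finsupp.single s 1)).support with hT
  have hsub : ∀ s ∈ S, (d (Finsupp.single s 1)).support ⊆ T := fun s hs =>
    Finset.subset_biUnion_of_mem (fun s => (d (Finsupp.single s 1)).support) hs
  obtain ⟨η, y, hy⟩ := hd S T (fun s t => d (Finsupp.single s.1 1) t.1)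
    (fun s => Finsupp.single s.1 1) (fun t => Finsupp.single t.1 1) (by
      intro s
      conv_lhs => rw [← Finsupp.sum_single (d (Finsupp.single s.1 1)),
        Finsupp.sum_of_support_subset _ (hsub s s.2) _ (by simp)]
      rw [← Finset.sum_coe_sort]
      simp)
  let k : (X →₀ A) →ₗ[A] (X →₀ A) :=
    Finsupp.linearCombination A fun x => if hx : x ∈ S then η ⟨x, hx⟩ else 0
  let h : (X →₀ A) →ₗ[A] (X →₀ A) :=
    Finsupp.linearCombination A fun x => if hx : x ∈ T then y ⟨x, hx⟩ else 0
  refine ⟨h, k, (insert x₀ S ∪ T) ∪ ((S.attach.biUnion fun s => (η s).support) ∪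
    (T.attach.biUnion fun t => (y t).support)), ?_, ?_, ?_, ?_, ?_, ?_⟩
  · intro s hs
    simp [hs]
  · simp
  · intro x hx
    refine Finsupp.map_mem_of_mem_supported (fun s hs => ?_) hx
    refine Finsupp.supported_mono ?_ (Finsupp.mem_supported_support A _)
    refine (Finset.coe_subset.2 (hsub s hs)).trans (Finset.coe_subset.2 ?_)
    exact (Finset.subset_union_right).trans Finset.subset_union_left
  · intro x
    have hx : x ∈ Finsupp.supported A A (Set.univ : Set X) := by simp
    refine Finsupp.map_mem_of_mem_supported (fun t _ => ?_) hx
    simp only [h, Finsupp.linearCombination_single, one_smul]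
    split_ifs with ht
    · refine Finsupp.supported_mono ?_ (Finsupp.mem_supported_support A _)
      refine Finset.coe_subset.2 ?_
      refine (Finset.subset_biUnion_of_mem (fun t => (y t).support)
        (Finset.mem_attach T ⟨t, ht⟩)).trans ?_
      exact (Finset.subset_union_right).trans Finset.subset_union_right
    · exact zero_mem _
  · intro x hx
    refine Finsupp.map_mem_of_mem_supported (fun s hs => ?_) hx
    have hs' : s ∈ S := hs
    simp only [k, Finsupp.linearCombination_single, one_smul, dif_pos hs']
    refine Finsupp.supported_mono ?_ (Finsupp.mem_supported_support A _)
    refine Finset.coe_subset.2 ?_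
    refine (Finset.subset_biUnion_of_mem (fun s => (η s).support)
      (Finset.mem_attach S ⟨s, hs⟩)).trans ?_
    exact (Finset.subset_union_left).trans Finset.subset_union_right
  · intro x hx
    refine Finsupp.map_eq_of_mem_supported (f := h ∘ₗ d + d ∘ₗ k) (g := LinearMap.id)
      (fun s hs => ?_) hx
    have hs' : s ∈ S := hs
    have h1 : h (d (Finsupp.single s 1)) = ∑ t : T, d (Finsupp.single s 1) t.1 • y t := by
      simp only [h, Finsupp.linearCombination_apply]
      rw [Finsupp.sum_of_support_subset _ (hsub s hs') _ (by simp), ← Finset.sum_coe_sort]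
      simp
    simp only [LinearMap.add_apply, LinearMap.comp_apply, LinearMap.id_apply, h1]
    simp only [k, Finsupp.linearCombination_single, one_smul, dif_pos hs']
    rw [add_comm]
    exact (hy ⟨s, hs'⟩).symm

/-- A Mittag-Leffler argument: the finite approximations along a chain of finite sets are corrected
until they stabilize. The limit `g` satisfies `d g = d` and `g d = 0` on the span of the union `Y`,
that is, it splits `d` onto its image. -/
theorem PureExact.exists_contraction_mem (hd : PureExact d) (hdd : ∀ x, d (d x) = 0) (x₀ : X) :
    ∃ (Y : Set X) (h : (X →₀ A) →ₗ[A] (X →₀ A)), x₀ ∈ Y ∧ IsContractionOn d Y h := by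
  classical
  choose H K N hN hx₀ hdN hHN hKN heq using hd.exists_contraction_on_finset x₀
  let S : ℕ → Finset X := fun n => N^[n] ∅
  have hS : ∀ n, S (n + 1) = N (S n) := fun n => Function.iterate_succ_apply' N n ∅
  have hmono : Monotone S := monotone_nat_of_le_succ fun n => by rw [hS]; exact hN _
  let Y : Set X := ⋃ n, (S n : Set X)
  have hSY : ∀ n, Finsupp.supported A A (S n : Set X) ≤ Finsupp.supported A A Y := fun n =>
    Finsupp.supported_mono (Set.subset_iUnion (fun n => (S n : Set X)) n)
  have hSS : ∀ {m n}, m ≤ n → Finsupp.supported A A (S m : Set X) ≤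
      Finsupp.supported A A (S n : Set X) := fun hmn =>
    Finsupp.supported_mono (Finset.coe_subset.2 (hmono hmn))
  have hYS : ∀ x ∈ Finsupp.supported A A Y, ∃ n, x ∈ Finsupp.supported A A (S n : Set X) := by
    intro x hx
    have hdir : Directed (· ≤ ·) fun n => Finsupp.supported A A (S n : Set X) :=
      (monotone_nat_of_le_succ fun n => hSS (Nat.le_succ n)).directed_le
    rwa [Finsupp.supported_iUnion, Submodule.mem_iSup_of_directed _ hdir] at hx
  have hdS : ∀ n, ∀ x ∈ Finsupp.supported A A (S n : Set X),
      d x ∈ Finsupp.supported A A (S (n + 1) : Set X) := fun n x hx => by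
    rw [hS]; exact hdN _ x hx
  have hKS : ∀ n, ∀ x ∈ Finsupp.supported A A (S n : Set X),
      K (S n) x ∈ Finsupp.supported A A (S (n + 1) : Set X) := fun n x hx => by
    rw [hS]; exact hKN _ x hx
  have hHS : ∀ n x, H (S n) x ∈ Finsupp.supported A A (S (n + 1) : Set X) := fun n x => by
    rw [hS]; exact hHN _ x
  have hdHd : ∀ {m n}, m ≤ n → ∀ x ∈ Finsupp.supported A A (S m : Set X),
      d (H (S n) (d x)) = d x := fun {m n} hmn x hx => by
    simpa [hdd] using congrArg d (heq (S n) x (hSS hmn hx))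
  -- The maps `H (S n) ∘ d` themselves need not converge. The correction vanishes on `S n`, where
  -- both differences reduce to `d x`, and applying `d` to it turns `d H (S n) d` into `d H (S (n +
  -- 1)) d`.
  let G : ℕ → (X →₀ A) →ₗ[A] (X →₀ A) := fun n => Nat.rec (H (S 0) ∘ₗ d)
    (fun n G => G + H (S (n + 2)) ∘ₗ (d ∘ₗ H (S (n + 1)) - d ∘ₗ H (S n)) ∘ₗ d) n
  have hG0 : ∀ x, G 0 x = H (S 0) (d x) := fun x => rfl
  have hGs : ∀ n x, G (n + 1) x = G n x +
      H (S (n + 2)) (d (H (S (n + 1)) (d x)) - d (H (S n) (d x))) := fun n x => rfl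
  have hGd : ∀ n x, G n (d x) = 0 := by
    intro n x
    induction n with
    | zero => simp [hG0, hdd]
    | succ n ih => simp [hGs, hdd, ih]
  have hdG : ∀ n x, d (G n x) = d (H (S n) (d x)) := by
    intro n x
    induction n with
    | zero => rfl
    | succ n ih =>
      rw [hGs, map_add, ih, map_sub, map_sub, hdHd (m := n + 2) le_rfl _ (hHS (n + 1) _),
        hdHd (m := n + 1) (Nat.le_succ _) _ (hHS n _)]
      abel
  have hGmem : ∀ n x, G n x ∈ Finsupp.supported A A Y := by
    intro n x
    induction n with
    | zero => exact hSY _ (hHS 0 _)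
    | succ n ih => exact add_mem ih (hSY _ (hHS (n + 2) _))
  have hGstab : ∀ {m n}, m ≤ n → ∀ x ∈ Finsupp.supported A A (S m : Set X), G n x = G m x := by
    intro m n hmn x hx
    induction n, hmn using Nat.le_induction with
    | base => rfl
    | succ n hmn ih =>
      rw [hGs, ih, hdHd hmn x hx, hdHd (hmn.trans (Nat.le_succ _)) x hx]
      simp
  have hYmem : ∀ x ∈ Y, ∃ n, x ∈ S n := fun x hx => by simpa [Y] using hx
  choose! ν hν using hYmem
  let g : (X →₀ A) →ₗ[A] (X →₀ A) :=
    Finsupp.linearCombination A fun x => G (ν x) (Finsupp.single x 1)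
  have hg : ∀ n, ∀ x ∈ Finsupp.supported A A (S n : Set X), g x = G n x := by
    intro n x hx
    refine Finsupp.map_eq_of_mem_supported (fun s hs => ?_) hx
    have hsY : s ∈ Y := Set.mem_iUnion.2 ⟨n, hs⟩
    simp only [g, Finsupp.linearCombination_single, one_smul]
    rw [← hGstab (le_max_left (ν s) n) _ (Finsupp.single_mem_supported A 1 (hν s hsY)),
      hGstab (le_max_right (ν s) n) _ (Finsupp.single_mem_supported A 1 hs)]
  have hdg : ∀ x ∈ Finsupp.supported A A Y, d (g x) = d x := by
    intro x hx
    obtain ⟨n, hn⟩ := hYS x hx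
    rw [hg n x hn, hdG, hdHd le_rfl x hn]
  have hgd : ∀ x ∈ Finsupp.supported A A Y, g (d x) = 0 := by
    intro x hx
    obtain ⟨n, hn⟩ := hYS x hx
    exact (hg (n + 1) _ (hdS n x hn)).trans (hGd (n + 1) x)
  have hgmem : ∀ x, x ∈ Finsupp.supported A A Y → g x ∈ Finsupp.supported A A Y := by
    intro x hx
    obtain ⟨n, hn⟩ := hYS x hx
    rw [hg n x hn]
    exact hGmem n x
  have hdmem : ∀ x ∈ Finsupp.supported A A Y, d x ∈ Finsupp.supported A A Y := by
    intro x hx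
    obtain ⟨n, hn⟩ := hYS x hx
    exact hSY _ (hdS n x hn)
  -- Since `d g = d`, the values of `1 - g` are cycles, and on cycles the finite-stage identity
  -- reads `d (K x) = x`.
  have hlift : ∀ s ∈ Y, ∃ z ∈ Finsupp.supported A A Y,
      d z = Finsupp.single s 1 - g (Finsupp.single s 1) := by
    intro s hs
    have hsY : Finsupp.single s 1 ∈ Finsupp.supported A A Y := Finsupp.single_mem_supported A 1 hs
    obtain ⟨n, hn⟩ := hYS _ (sub_mem hsY (hgmem _ hsY))
    refine ⟨_, hSY _ (hKS n _ hn), ?_⟩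
    simpa [hdg _ hsY] using heq (S n) _ hn
  choose! z hzmem hz using hlift
  let k : (X →₀ A) →ₗ[A] (X →₀ A) := Finsupp.linearCombination A z
  have hdk : ∀ x ∈ Finsupp.supported A A Y, d (k x) = x - g x := by
    intro x hx
    refine Finsupp.map_eq_of_mem_supported (f := d ∘ₗ k) (g := LinearMap.id - g)
      (fun s hs => ?_) hx
    simp [k, hz s hs]
  have hkmem : ∀ x ∈ Finsupp.supported A A Y, k x ∈ Finsupp.supported A A Y := by
    intro x hx
    refine Finsupp.map_mem_of_mem_supported (fun s hs => ?_) hx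
    simpa [k] using hzmem s hs
  refine ⟨Y, g ∘ₗ k, ?_, hdmem, fun x hx => hgmem _ (hkmem x hx), fun x hx => ?_⟩
  · refine Set.mem_iUnion.2 ⟨1, ?_⟩
    rw [hS]
    exact hx₀ _
  -- The cycle `k d x - x` is a boundary within `Y`, and `g` kills such boundaries. So `g k d = g`,
  -- while `d g k = d k = 1 - g`.
  · have hkd : d (k (d x) - x) = 0 := by
      rw [map_sub, hdk _ (hdmem x hx), hgd x hx]
      simp
    have hmem := sub_mem (hkmem _ (hdmem x hx)) hx
    obtain ⟨n, hn⟩ := hYS _ hmem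
    have h1 := heq (S n) _ hn
    rw [hkd, map_zero, zero_add] at h1
    have h2 : g (k (d x) - x) = 0 := by
      rw [← h1]
      exact hgd _ (hSY _ (hKS n _ hn))
    rw [map_sub, sub_eq_zero] at h2
    simp only [LinearMap.comp_apply]
    rw [h2, hdg _ (hkmem x hx), hdk x hx]
    abel

end Contraction

/-! ### Quotients by contractible coordinate subcomplexes, and Zorn's lemma -/

section Quotient

variable {A : Type u} [Ring A] {X : Type u}

/-- Extension by zero of finitely supported functions on a subset. -/
noncomputable def Finsupp.extendByZero (A : Type u) [Ring A] (Y : Set X) :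
    (Y →₀ A) →ₗ[A] (X →₀ A) :=
  Finsupp.lmapDomain A A Subtype.val

/-- Restriction of finitely supported functions to a subset. -/
noncomputable def Finsupp.restrictTo (A : Type u) [Ring A] (Y : Set X) :
    (X →₀ A) →ₗ[A] (Y →₀ A) :=
  Finsupp.lsubtypeDomain Y

theorem Finsupp.restrictTo_extendByZero (Y : Set X) (x : Y →₀ A) :
    Finsupp.restrictTo A Y (Finsupp.extendByZero A Y x) = x := by
  ext y
  exact Finsupp.mapDomain_apply Subtype.val_injective x y

theorem Finsupp.restrictTo_compl_eq_zero_iff {Y : Set X} {x : X →₀ A} :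
    Finsupp.restrictTo A Yᶜ x = 0 ↔ x ∈ Finsupp.supported A A Y := by
  rw [Finsupp.mem_supported', DFunLike.ext_iff]
  exact ⟨fun h a ha => h ⟨a, ha⟩, fun h a => h a a.2⟩

theorem Finsupp.restrictTo_compl_mem_supported_iff {Y : Set X} {Z : Set ↥Yᶜ} {x : X →₀ A} :
    Finsupp.restrictTo A Yᶜ x ∈ Finsupp.supported A A Z ↔
      x ∈ Finsupp.supported A A (Y ∪ Subtype.val '' Z) := by
  rw [Finsupp.mem_supported', Finsupp.mem_supported']
  constructor
  · intro h a ha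
    simp only [Set.mem_union, not_or] at ha
    exact h ⟨a, ha.1⟩ fun hz => ha.2 ⟨_, hz, rfl⟩
  · rintro h ⟨a, ha⟩ haz
    refine h a ?_
    rintro (h' | ⟨b, hb, rfl⟩)
    · exact ha h'
    · exact haz hb

variable {d : (X →₀ A) →ₗ[A] (X →₀ A)}

/-- The differential induced on the quotient by the submodule spanned by `Y`. -/
noncomputable def complDifferential (d : (X →₀ A) →ₗ[A] (X →₀ A)) (Y : Set X) :
    (↥Yᶜ →₀ A) →ₗ[A] (↥Yᶜ →₀ A) :=
  Finsupp.restrictTo A Yᶜ ∘ₗ d ∘ₗ Finsupp.extendByZero A Yᶜ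

theorem IsContractionOn.restrictTo_d {Y : Set X} {h : (X →₀ A) →ₗ[A] (X →₀ A)}
    (hY : IsContractionOn d Y h) (x : X →₀ A) :
    Finsupp.restrictTo A Yᶜ (d x) = complDifferential d Y (Finsupp.restrictTo A Yᶜ x) := by
  have h1 : x - Finsupp.extendByZero A Yᶜ (Finsupp.restrictTo A Yᶜ x) ∈
      Finsupp.supported A A Y := by
    rw [← Finsupp.restrictTo_compl_eq_zero_iff, map_sub, Finsupp.restrictTo_extendByZero, sub_self]
  have h2 := Finsupp.restrictTo_compl_eq_zero_iff.2 (hY.d_mem _ h1)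
  rwa [map_sub, map_sub, sub_eq_zero] at h2

theorem IsContractionOn.complDifferential_sq {Y : Set X} {h : (X →₀ A) →ₗ[A] (X →₀ A)}
    (hY : IsContractionOn d Y h) (hdd : ∀ x, d (d x) = 0) (x : ↥Yᶜ →₀ A) :
    complDifferential d Y (complDifferential d Y x) = 0 := by
  conv_lhs => enter [2]; rw [complDifferential]
  simp only [LinearMap.comp_apply]
  rw [← hY.restrictTo_d, hdd, map_zero]

/-- A system over the quotient lifts up to a defect `w` in the span of `Y`. Subtracting `h w` from
the lifted `m` and `h d v` from the lifted `v` removes the defect. The solution upstairs then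
projects to one for `m`, because `h w` dies in the quotient. -/
theorem IsContractionOn.pureExact_complDifferential {Y : Set X}
    {h : (X →₀ A) →ₗ[A] (X →₀ A)} (hY : IsContractionOn d Y h) (hdd : ∀ x, d (d x) = 0)
    (hd : PureExact d) : PureExact (complDifferential d Y) := by
  intro σ τ _ _ a m v hm
  let i := Finsupp.extendByZero A Yᶜ
  let r := Finsupp.restrictTo A Yᶜ
  have hri : ∀ x, r (i x) = x := Finsupp.restrictTo_extendByZero _
  let w : σ → (X →₀ A) := fun s => d (i (m s)) - ∑ t, a s t • i (v t)
  have hw : ∀ s, w s ∈ Finsupp.supported A A Y := by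
    intro s
    rw [← Finsupp.restrictTo_compl_eq_zero_iff]
    change r _ = 0
    rw [map_sub, sub_eq_zero]
    refine (hm s).trans ?_
    simp [hri]
  have hdw : ∀ s, d (w s) = - ∑ t, a s t • d (i (v t)) := by
    intro s
    simp [w, hdd]
  obtain ⟨η, y, hy⟩ := hd σ τ a (fun s => i (m s) - h (w s))
    (fun t => i (v t) - h (d (i (v t)))) (by
      intro s
      have h1 := hY.eq _ (hw s)
      rw [hdw] at h1
      have h2 : d (h (w s)) = w s + ∑ t, a s t • h (d (i (v t))) := by
        rw [eq_comm, ← sub_eq_iff_eq_add'.2 h1.symm]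
        simp
      rw [map_sub, h2]
      simp only [smul_sub, Finset.sum_sub_distrib, w]
      abel)
  refine ⟨fun s => r (η s), fun t => r (y t), fun s => ?_⟩
  have h3 := congrArg r (hy s)
  rw [map_sub, hri, Finsupp.restrictTo_compl_eq_zero_iff.2 (hY.h_mem _ (hw s)), sub_zero] at h3
  rw [h3, ← hY.restrictTo_d]
  simp [r]

/-- Gluing `h` and `k` along the coordinate splitting gives `h₁`, whose error `ε` is a chain map,
vanishes on `Y` and maps the enlarged subcomplex into the span of `Y`. There `h` contracts, so `h₁ +
h ε` has no error. -/
theorem IsContractionOn.extend {Y : Set X} {h : (X →₀ A) →ₗ[A] (X →₀ A)}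
    (hY : IsContractionOn d Y h) (hdd : ∀ x, d (d x) = 0) {Z : Set ↥Yᶜ}
    {k : (↥Yᶜ →₀ A) →ₗ[A] (↥Yᶜ →₀ A)} (hZ : IsContractionOn (complDifferential d Y) Z k) :
    ∃ h' : (X →₀ A) →ₗ[A] (X →₀ A), IsContractionOn d (Y ∪ Subtype.val '' Z) h' ∧
      ∀ x ∈ Finsupp.supported A A Y, h' x = h x := by
  let i := Finsupp.extendByZero A Yᶜ
  let r := Finsupp.restrictTo A Yᶜ
  have hri : ∀ x, r (i x) = x := Finsupp.restrictTo_extendByZero _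
  have hr0 : ∀ {x}, r x = 0 ↔ x ∈ Finsupp.supported A A Y := Finsupp.restrictTo_compl_eq_zero_iff
  have hrd : ∀ x, r (d x) = complDifferential d Y (r x) := hY.restrictTo_d
  let h₁ : (X →₀ A) →ₗ[A] (X →₀ A) := h ∘ₗ (LinearMap.id - i ∘ₗ r) + i ∘ₗ k ∘ₗ r
  have hh₁ : ∀ x ∈ Finsupp.supported A A Y, h₁ x = h x := fun x hx => by
    simp [h₁, hr0.2 hx]
  have hrh₁ : ∀ x, r (h₁ x) = k (r x) := fun x => by
    have : r (h (x - i (r x))) = 0 := hr0.2 (hY.h_mem _ (hr0.1 (by simp [hri])))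
    simp only [h₁, LinearMap.add_apply, LinearMap.comp_apply, LinearMap.sub_apply,
      LinearMap.id_apply, map_add, this, hri, zero_add]
  let ε : (X →₀ A) →ₗ[A] (X →₀ A) := LinearMap.id - h₁ ∘ₗ d - d ∘ₗ h₁
  have hε : ∀ x, ε x = x - h₁ (d x) - d (h₁ x) := fun x => rfl
  have hεY : ∀ x ∈ Finsupp.supported A A Y, ε x = 0 := fun x hx => by
    rw [hε, hh₁ x hx, hh₁ _ (hY.d_mem x hx), sub_sub, hY.eq x hx, sub_self]
  have hεd : ∀ x, ε (d x) = d (ε x) := fun x => by simp [hε, hdd]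
  have hεmem : ∀ x, r x ∈ Finsupp.supported A A Z → ε x ∈ Finsupp.supported A A Y := by
    intro x hx
    rw [← hr0, hε, map_sub, map_sub, hrh₁, hrd, hrd, hrh₁, sub_sub, hZ.eq _ hx, sub_self]
  refine ⟨h₁ + h ∘ₗ ε, ⟨fun x hx => ?_, fun x hx => ?_, fun x hx => ?_⟩, fun x hx => ?_⟩
  · rw [← Finsupp.restrictTo_compl_mem_supported_iff] at hx ⊢
    change r _ ∈ _
    rw [hrd]
    exact hZ.d_mem _ hx
  · rw [← Finsupp.restrictTo_compl_mem_supported_iff] at hx ⊢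
    change r (h₁ x + h (ε x)) ∈ _
    rw [map_add, hrh₁, hr0.2 (hY.h_mem _ (hεmem x hx)), add_zero]
    exact hZ.h_mem _ hx
  · rw [← Finsupp.restrictTo_compl_mem_supported_iff] at hx
    change h₁ (d x) + h (ε (d x)) + d (h₁ x + h (ε x)) = x
    have h1 := hY.eq _ (hεmem x hx)
    rw [hεd, map_add]
    calc _ = h₁ (d x) + d (h₁ x) + (h (d (ε x)) + d (h (ε x))) := by abel
      _ = x := by rw [h1, hε]; abel
  · change h₁ x + h (ε x) = h x
    rw [hεY x hx, map_zero, add_zero, hh₁ x hx]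

/-- Pairs (subset, contraction) are ordered by inclusion with agreement on the smaller span. A basis
element outside a maximal subset would lie in a contractible piece of the quotient, and the
contraction would extend. -/
theorem PureExact.exists_contraction_of_finsupp (hd : PureExact d) (hdd : ∀ x, d (d x) = 0) :
    ∃ h : (X →₀ A) →ₗ[A] (X →₀ A), ∀ x, h (d x) + d (h x) = x := by
  classical
  let I := {p : Set X × ((X →₀ A) →ₗ[A] (X →₀ A)) // IsContractionOn d p.1 p.2}
  let R : I → I → Prop := fun p q => p.1.1 ⊆ q.1.1 ∧
    ∀ x ∈ Finsupp.supported A A p.1.1, q.1.2 x = p.1.2 x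
  have hRrefl : ∀ p, R p p := fun p => ⟨subset_rfl, fun _ _ => rfl⟩
  have hRtrans : ∀ {p q s}, R p q → R q s → R p s := fun {p q s} h h' =>
    ⟨h.1.trans h'.1, fun x hx =>
      (h'.2 x (Finsupp.supported_mono h.1 hx)).trans (h.2 x hx)⟩
  obtain ⟨⟨⟨Y, h⟩, hY⟩, hmax⟩ := exists_maximal_of_chains_bounded (r := R) (by
    intro c hc
    have htot : ∀ p ∈ c, ∀ q ∈ c, R p q ∨ R q p := fun p hp q hq => by
      by_cases hpq : p = q
      · exact Or.inl (hpq ▸ hRrefl p)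
      · exact hc hp hq hpq
    let Y : Set X := ⋃ p : c, p.1.1.1
    have hYmem : ∀ x ∈ Y, ∃ p : I, p ∈ c ∧ x ∈ p.1.1 := fun x hx => by
      obtain ⟨p, hp⟩ := Set.mem_iUnion.1 hx
      exact ⟨p.1, p.2, hp⟩
    rcases c.eq_empty_or_nonempty with rfl | hne
    · exact ⟨⟨(∅, 0), by constructor <;> simp⟩, by simp⟩
    have hne' : Nonempty c := hne.to_subtype
    let h : (X →₀ A) →ₗ[A] (X →₀ A) := Finsupp.linearCombination A fun x =>
      if hx : x ∈ Y then (hYmem x hx).choose.1.2 (Finsupp.single x 1) else 0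
    have hh : ∀ p ∈ c, ∀ x ∈ Finsupp.supported A A p.1.1, h x = p.1.2 x := by
      intro p hp x hx
      refine Finsupp.map_eq_of_mem_supported (fun s hs => ?_) hx
      have hsY : s ∈ Y := Set.mem_iUnion.2 ⟨⟨p, hp⟩, hs⟩
      simp only [h, Finsupp.linearCombination_single, one_smul, dif_pos hsY]
      obtain ⟨hqc, hsq⟩ := (hYmem s hsY).choose_spec
      rcases htot _ hqc p hp with hR | hR
      · exact (hR.2 _ (Finsupp.single_mem_supported A 1 hsq)).symm
      · exact hR.2 _ (Finsupp.single_mem_supported A 1 hs)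
    have hsub : ∀ p ∈ c, p.1.1 ⊆ Y := fun p hp =>
      Set.subset_iUnion (fun p : c => p.1.1.1) ⟨p, hp⟩
    have hYS : ∀ x ∈ Finsupp.supported A A Y, ∃ p ∈ c, x ∈ Finsupp.supported A A p.1.1 := by
      intro x hx
      have hdir : Directed (· ≤ ·) fun p : c => Finsupp.supported A A p.1.1.1 := by
        rintro ⟨p, hp⟩ ⟨q, hq⟩
        rcases htot p hp q hq with hR | hR
        · exact ⟨⟨q, hq⟩, Finsupp.supported_mono hR.1, le_rfl⟩
        · exact ⟨⟨p, hp⟩, le_rfl, Finsupp.supported_mono hR.1⟩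
      rw [Finsupp.supported_iUnion, Submodule.mem_iSup_of_directed _ hdir] at hx
      obtain ⟨p, hp⟩ := hx
      exact ⟨p.1, p.2, hp⟩
    refine ⟨⟨(Y, h), fun x hx => ?_, fun x hx => ?_, fun x hx => ?_⟩,
      fun p hp => ⟨hsub p hp, hh p hp⟩⟩ <;>
    obtain ⟨p, hp, hxp⟩ := hYS x hx
    · exact Finsupp.supported_mono (hsub p hp) (p.2.d_mem x hxp)
    · change h x ∈ _
      rw [hh p hp x hxp]
      exact Finsupp.supported_mono (hsub p hp) (p.2.h_mem x hxp)
    · change h (d x) + d (h x) = x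
      rw [hh p hp x hxp, hh p hp _ (p.2.d_mem x hxp)]
      exact p.2.eq x hxp) hRtrans
  have hYuniv : Y = Set.univ := by
    refine Set.eq_univ_of_forall fun x₀ => by_contra fun hx₀ => hx₀ ?_
    obtain ⟨Z, k, hxZ, hZ⟩ := (hY.pureExact_complDifferential hdd hd).exists_contraction_mem
      (hY.complDifferential_sq hdd) ⟨x₀, hx₀⟩
    obtain ⟨h', hh', hext⟩ := hY.extend hdd hZ
    exact (hmax ⟨(_, h'), hh'⟩ ⟨Set.subset_union_left, hext⟩).1 (Or.inr ⟨_, hxZ, rfl⟩)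
  subst hYuniv
  exact ⟨h, fun x => hY.eq x (by simp)⟩

end Quotient

/-! ### Reduction from projective to free modules -/

section Swindle

variable {A : Type u} [Ring A] {T G : Type u} [AddCommGroup T] [Module A T] [AddCommGroup G]
  [Module A G]

/-- The Eilenberg swindle: countably many copies of a module absorb each of its retracts. -/
noncomputable def eilenbergSwindle (s : T →ₗ[A] G) (p : G →ₗ[A] T) (hps : ∀ t, p (s t) = t) :
    (T × (ℕ →₀ G)) ≃ₗ[A] (ℕ →₀ G) :=
  have hS : Function.Injective Nat.succ := Nat.succ_injective
  have h0 : (0 : ℕ) ∉ Set.range Nat.succ := by simp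
  LinearEquiv.ofLinearMap
    -- With `G = T ⊕ ker p`, only the `T`-components are shifted by one; the new `T` fills the
    -- vacant slot 0.
    (LinearMap.coprod (Finsupp.lsingle 0 ∘ₗ s)
      (Finsupp.mapRange.linearMap (LinearMap.id - s ∘ₗ p) +
        Finsupp.lmapDomain G A Nat.succ ∘ₗ Finsupp.mapRange.linearMap (s ∘ₗ p)))
    (LinearMap.prod (p ∘ₗ Finsupp.lapply 0)
      (Finsupp.mapRange.linearMap (LinearMap.id - s ∘ₗ p) +
        Finsupp.lcomapDomain Nat.succ hS ∘ₗ Finsupp.mapRange.linearMap (s ∘ₗ p)))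
    (by
      refine LinearMap.ext fun g => Finsupp.ext fun n => ?_
      cases n with
      | zero => simp [Finsupp.lcomapDomain, Finsupp.mapDomain_of_notMem_range _ _ h0, hps]
      | succ n =>
        have (f : ℕ →₀ G) := Finsupp.mapDomain_apply hS f n
        simp only [Nat.succ_eq_add_one] at this
        simp [Finsupp.lcomapDomain, this, hps])
    (by
      refine LinearMap.ext fun ⟨t, f⟩ => Prod.ext ?_ (Finsupp.ext fun n => ?_)
      · simp [Finsupp.mapDomain_of_notMem_range _ _ h0, hps]
      · have (f : ℕ →₀ G) := Finsupp.mapDomain_apply hS f n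
        simp only [Nat.succ_eq_add_one] at this
        cases n with
        | zero => simp [Finsupp.lcomapDomain, Finsupp.mapDomain_of_notMem_range _ _ h0, this, hps]
        | succ n =>
          have h' (f : ℕ →₀ G) := Finsupp.mapDomain_apply hS f n
          simp only [Nat.succ_eq_add_one] at h'
          simp [Finsupp.lcomapDomain, this, h', hps])

/-- Two copies of `V` are added so that the complement can carry the contractible differential `(v,
w) ↦ (w, 0)`. -/
theorem Module.Projective.exists_prod_equiv_finsupp (A : Type u) [Ring A] (T : Type u)
    [AddCommGroup T] [Module A T] [Module.Projective A T] :
    ∃ (X V : Type u) (_ : AddCommGroup V) (_ : Module A V),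
      Nonempty ((T × V × V) ≃ₗ[A] (X →₀ A)) := by
  obtain ⟨s, hs⟩ := Module.projective_lifting_property
    (Finsupp.linearCombination A (id : T → T)) LinearMap.id
    (Finsupp.linearCombination_id_surjective A T)
  let e := eilenbergSwindle s (Finsupp.linearCombination A (id : T → T)) (LinearMap.congr_fun hs)
  let c : (ℕ →₀ (T →₀ A)) ≃ₗ[A] (ℕ × T →₀ A) := (Finsupp.curryLinearEquiv A).symm
  exact ⟨(ℕ × T) ⊕ (ℕ × T), ℕ →₀ (T →₀ A), inferInstance, inferInstance,
    ⟨(LinearEquiv.prodAssoc A _ _ _).symm.trans <|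
      ((e.trans c).prodCongr c).trans (Finsupp.sumFinsuppLEquivProdFinsupp A).symm⟩⟩

theorem PureExact.exists_contraction [Module.Projective A T] {d : T →ₗ[A] T} (hd : PureExact d)
    (hdd : ∀ x, d (d x) = 0) : ∃ h : T →ₗ[A] T, ∀ x, h (d x) + d (h x) = x := by
  obtain ⟨X, V, _, _, ⟨e⟩⟩ := Module.Projective.exists_prod_equiv_finsupp A T
  let c : (V × V) →ₗ[A] (V × V) := LinearMap.inl A V V ∘ₗ LinearMap.snd A V V
  have hc : PureExact c :=
    PureExact.of_contraction (LinearMap.inr A V V ∘ₗ LinearMap.fst A V V) fun x => by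
      ext <;> simp [c]
  obtain ⟨h, hh⟩ := ((hd.prod hc).conj e).exists_contraction_of_finsupp fun x => by
    simp [c, hdd]
  -- The differential is block diagonal, so the `T`-block of a contraction contracts `d`.
  refine ⟨LinearMap.fst A T _ ∘ₗ e.symm.toLinearMap ∘ₗ h ∘ₗ e.toLinearMap ∘ₗ LinearMap.inl A T _,
    fun x => ?_⟩
  simpa using congrArg (fun y => (e.symm y).1) (hh (e (x, 0)))

end Swindle

/-! ### From differential modules back to complexes -/

section Graded

variable {A : Type u} [Ring A] {M : ℤ → Type u} [∀ n, AddCommGroup (M n)] [∀ n, Module A (M n)]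

/-- The total differential on the direct sum of the terms of a cochain complex. -/
noncomputable def totalDifferential (δ : ∀ n, M n →ₗ[A] M (n + 1)) :
    DirectSum ℤ M →ₗ[A] DirectSum ℤ M :=
  DirectSum.toModule A ℤ _ fun n => DirectSum.lof A ℤ M (n + 1) ∘ₗ δ n

variable {δ : ∀ n, M n →ₗ[A] M (n + 1)}

theorem totalDifferential_lof (n : ℤ) (x : M n) :
    totalDifferential δ (DirectSum.lof A ℤ M n x) = DirectSum.lof A ℤ M (n + 1) (δ n x) := by
  simp [totalDifferential]

theorem totalDifferential_apply (n : ℤ) (x : DirectSum ℤ M) :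
    totalDifferential δ x (n + 1) = δ n (x n) := by
  have : DirectSum.component A ℤ M (n + 1) ∘ₗ totalDifferential δ =
      δ n ∘ₗ DirectSum.component A ℤ M n := by
    refine DirectSum.linearMap_ext A fun m => LinearMap.ext fun y => ?_
    simp only [LinearMap.comp_apply, totalDifferential_lof]
    by_cases h : m = n
    · subst h
      simp [DirectSum.component.lof_self]
    · rw [DirectSum.component.of, DirectSum.component.of, dif_neg (by omega), dif_neg h, map_zero]
  exact LinearMap.congr_fun this x

theorem totalDifferential_sq (hδ : ∀ n x, δ (n + 1) (δ n x) = 0) (x : DirectSum ℤ M) :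
    totalDifferential δ (totalDifferential δ x) = 0 := by
  have : totalDifferential δ ∘ₗ totalDifferential δ = 0 := by
    refine DirectSum.linearMap_ext A fun m => LinearMap.ext fun y => ?_
    simp [totalDifferential_lof, hδ]
  exact LinearMap.congr_fun this x

theorem pureExact_totalDifferential
    (hE : ∀ (n : ℤ) (σ τ : Type u) [Fintype σ] [Fintype τ] (a : σ → τ → A) (m : σ → M (n + 1))
      (v : τ → M (n + 1 + 1)), (∀ s, δ (n + 1) (m s) = ∑ t, a s t • v t) →
        ∃ (η : σ → M n) (y : τ → M (n + 1)), ∀ s, m s = δ n (η s) + ∑ t, a s t • y t) :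
    PureExact (totalDifferential δ) := by
  classical
  intro σ τ _ _ a m v hm
  have hE' := fun n => hE n σ τ a (fun s => m s (n + 1)) (fun t => v t (n + 1 + 1)) fun s => by
    rw [← totalDifferential_apply, hm]
    simp [DirectSum.sum_apply, DirectSum.smul_apply]
  choose η y h using hE'
  let J : Finset ℤ := Finset.univ.biUnion fun s => DFinsupp.support (m s)
  -- The solution indexed by `n` treats the component in degree `n + 1`, so the degrees in the
  -- supports are lowered by one. Finiteness of `I` keeps the assembled solution in the direct sum.
  let I : Finset ℤ := J.map (Equiv.subRight (1 : ℤ)).toEmbedding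
  have hmI : ∀ s, m s = ∑ n ∈ I, DirectSum.lof A ℤ M (n + 1) (m s (n + 1)) := by
    intro s
    rw [Finset.sum_map]
    have : ∀ k, DirectSum.lof A ℤ M (k - 1 + 1) (m s (k - 1 + 1)) =
        DirectSum.lof A ℤ M k (m s k) := fun k => by rw [sub_add_cancel]
    conv_lhs => rw [← DirectSum.sum_support_of (m s)]
    refine (Finset.sum_subset (Finset.subset_biUnion_of_mem (fun s => DFinsupp.support (m s))
      (Finset.mem_univ s)) fun k _ hk => ?_).trans (Finset.sum_congr rfl fun k _ => (this k).symm)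
    exact (congrArg (DirectSum.of M k) (DFinsupp.notMem_support_iff.1 hk)).trans (map_zero _)
  refine ⟨fun s => ∑ n ∈ I, DirectSum.lof A ℤ M n (η n s),
    fun t => ∑ n ∈ I, DirectSum.lof A ℤ M (n + 1) (y n t), fun s => ?_⟩
  rw [hmI s]
  simp only [h, map_add, map_sum, map_smul, Finset.sum_add_distrib, Finset.smul_sum,
    totalDifferential_lof]
  rw [Finset.sum_comm]

theorem exists_graded_contraction [∀ n, Module.Projective A (M n)]
    (hδ : ∀ n x, δ (n + 1) (δ n x) = 0)
    (hE : ∀ (n : ℤ) (σ τ : Type u) [Fintype σ] [Fintype τ] (a : σ → τ → A) (m : σ → M (n + 1))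
      (v : τ → M (n + 1 + 1)), (∀ s, δ (n + 1) (m s) = ∑ t, a s t • v t) →
        ∃ (η : σ → M n) (y : τ → M (n + 1)), ∀ s, m s = δ n (η s) + ∑ t, a s t • y t) :
    ∃ h : ∀ n, M (n + 1) →ₗ[A] M n, ∀ n x, h (n + 1) (δ (n + 1) x) + δ n (h n x) = x := by
  have : Module.Projective A (DirectSum ℤ M) := inferInstance
  obtain ⟨h, hh⟩ := (pureExact_totalDifferential hE).exists_contraction (totalDifferential_sq hδ)
  refine ⟨fun n => DirectSum.component A ℤ M n ∘ₗ h ∘ₗ DirectSum.lof A ℤ M (n + 1),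
    fun n x => ?_⟩
  have := congrArg (fun z => z (n + 1)) (hh (DirectSum.lof A ℤ M (n + 1) x))
  simp only [totalDifferential_lof, DirectSum.add_apply, totalDifferential_apply] at this
  refine this.trans (DirectSum.component.lof_self A (n + 1) x)

end Graded

/-! ### Tensoring with the cokernel of a matrix -/

section MatrixCokernel

variable {A : Type u} [Ring A] {σ τ : Type u} (a : σ → τ → A)

/-- The right submodule of `A^σ` spanned by the columns of a matrix. -/
def columnSpan : Submodule Aᵐᵒᵖ (σ → A) :=
  Submodule.span Aᵐᵒᵖ (Set.range fun t s => a s t)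

/-- The subgroup `a M^τ` of `M^σ` attached to a matrix `a`. -/
def matrixImage [Fintype τ] (M : Type u) [AddCommGroup M] [Module A M] : AddSubgroup (σ → M) where
  carrier := {x | ∃ y : τ → M, ∀ s, x s = ∑ t, a s t • y t}
  zero_mem' := ⟨0, by simp⟩
  add_mem' := by
    rintro x x' ⟨y, hy⟩ ⟨y', hy'⟩
    exact ⟨y + y', fun s => by simp [hy, hy', Finset.sum_add_distrib]⟩
  neg_mem' := by
    rintro x ⟨y, hy⟩
    exact ⟨-y, fun s => by simp [hy]⟩

variable {M : Type u} [AddCommGroup M] [Module A M]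

theorem smul_mem_matrixImage [Fintype τ] {c : σ → A} (hc : c ∈ columnSpan a) (x : M) :
    (fun s => c s • x) ∈ matrixImage a M := by
  classical
  induction hc using Submodule.span_induction generalizing x with
  | mem c hc =>
    obtain ⟨t, rfl⟩ := hc
    refine ⟨Pi.single t x, fun s => ?_⟩
    rw [Finset.sum_eq_single t (fun t' _ ht => by simp [ht]) (by simp)]
    simp
  | zero => exact ⟨0, by simp⟩
  | add c c' _ _ h h' =>
    simp only [Pi.add_apply, add_smul]
    exact add_mem (h x) (h' x)
  | smul r c _ h =>
    simpa [mul_smul] using h (r.unop • x)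

/-- The pairing `A^σ × M → M^σ / a M^τ`. -/
def matrixPairing [Fintype τ] (M : Type u) [AddCommGroup M] [Module A M] :
    (σ → A) →+ M →+ (σ → M) ⧸ matrixImage a M :=
  AddMonoidHom.mk' (fun c => AddMonoidHom.mk' (fun x => QuotientAddGroup.mk fun s => c s • x)
    fun x y => by rw [← QuotientAddGroup.mk_add]; congr 1; ext s; exact smul_add _ _ _)
    fun c c' => by
      ext x
      change (QuotientAddGroup.mk _ : _ ⧸ matrixImage a M) = QuotientAddGroup.mk _ +
        QuotientAddGroup.mk _
      rw [← QuotientAddGroup.mk_add]; congr 1; ext s; exact add_smul _ _ _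

/-- The pairing of the cokernel of a matrix with a module. -/
def cokernelPairing [Fintype τ] (M : Type u) [AddCommGroup M] [Module A M] :
    ((σ → A) ⧸ columnSpan a) →+ M →+ (σ → M) ⧸ matrixImage a M :=
  QuotientAddGroup.lift (columnSpan a).toAddSubgroup (matrixPairing a M) fun c hc =>
    AddMonoidHom.ext fun x =>
      (QuotientAddGroup.eq_zero_iff fun s => c s • x).2 (smul_mem_matrixImage a hc x)

/-- The comparison map from the tensor product of the cokernel of a matrix with `M` to the
cokernel of the matrix on `M`. -/
def cokernelTensorMap [Fintype τ] (M : Type u) [AddCommGroup M] [Module A M] :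
    BalancedTensor A ((σ → A) ⧸ columnSpan a) M →ₗ[ℤ] (σ → M) ⧸ matrixImage a M :=
  Submodule.liftQ _
    (TensorProduct.liftAddHom (cokernelPairing a M) fun r n x =>
      (DFunLike.congr_fun (map_zsmul (cokernelPairing a M) r n) x).trans
        (map_zsmul (cokernelPairing a M n) r x).symm).toIntLinearMap
    (by
      refine Submodule.span_le.2 ?_
      rintro _ ⟨n, r, x, rfl⟩
      obtain ⟨c, rfl⟩ := Submodule.Quotient.mk_surjective _ n
      refine (map_sub _ _ _).trans (sub_eq_zero.2 ?_)
      refine congrArg QuotientAddGroup.mk (funext fun s => ?_)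
      exact mul_smul (c s) r x)

end MatrixCokernel

/-! ### From tensor exactness to linear equations -/

section TensorExact

variable {A : Type u} [Ring A] {M₁ M₂ M₃ : Type u} [AddCommGroup M₁] [Module A M₁]
  [AddCommGroup M₂] [Module A M₂] [AddCommGroup M₃] [Module A M₃]

theorem exists_cokernelTensorMap_map {σ τ : Type u} [Fintype τ] (a : σ → τ → A)
    (f : M₁ →ₗ[A] M₂) (z : BalancedTensor A ((σ → A) ⧸ columnSpan a) M₁) :
    ∃ η : σ → M₁, cokernelTensorMap a M₂ (BalancedTensor.map A _ f z) =
      QuotientAddGroup.mk fun s => f (η s) := by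
  obtain ⟨z, rfl⟩ := Submodule.Quotient.mk_surjective _ z
  induction z using TensorProduct.induction_on with
  | zero => exact ⟨0, by simp; rfl⟩
  | tmul n x =>
    obtain ⟨c, rfl⟩ := Submodule.Quotient.mk_surjective _ n
    refine ⟨fun s => c s • x, ?_⟩
    simp only [map_smul]
    rfl
  | add z z' h h' =>
    obtain ⟨η, h⟩ := h
    obtain ⟨η', h'⟩ := h'
    refine ⟨η + η', ?_⟩
    rw [Submodule.Quotient.mk_add, map_add, map_add, h, h', ← QuotientAddGroup.mk_add]
    congr 1
    ext s
    simp

/-- Take `N` to be the cokernel of the matrix. The system says that `∑ e s ⊗ m s` dies in `N ⊗ M₃`,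
since the columns vanish in `N`. Hence it comes from `N ⊗ M₁`, and the comparison map to `M₂^σ / a
M₂^τ` turns this into the required congruence. Bijectivity of the comparison map is not needed. -/
theorem exists_matrix_solution_of_tensor_exact (f : M₁ →ₗ[A] M₂) (g : M₂ →ₗ[A] M₃)
    (hex : ∀ (N : Type u) [AddCommGroup N] [Module Aᵐᵒᵖ N] (w : BalancedTensor A N M₂),
      BalancedTensor.map A N g w = 0 → ∃ z, BalancedTensor.map A N f z = w)
    {σ τ : Type u} [Fintype σ] [Fintype τ] (a : σ → τ → A) (m : σ → M₂) (v : τ → M₃)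
    (hm : ∀ s, g (m s) = ∑ t, a s t • v t) :
    ∃ (η : σ → M₁) (y : τ → M₂), ∀ s, m s = f (η s) + ∑ t, a s t • y t := by
  classical
  let N := (σ → A) ⧸ columnSpan a
  let e : σ → N := fun s => Submodule.Quotient.mk (Pi.single s 1)
  have he : ∀ t, ∑ s, MulOpposite.op (a s t) • e s = 0 := by
    intro t
    have : ∑ s, MulOpposite.op (a s t) • e s =
        Submodule.Quotient.mk (p := columnSpan a) fun s => a s t := by
      change ∑ s, MulOpposite.op (a s t) • (columnSpan a).mkQ (Pi.single s 1) =
        (columnSpan a).mkQ fun s => a s t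
      simp only [← map_smul, ← map_sum]
      congr 1
      ext s
      simp [Finset.sum_apply, Pi.single_apply]
    rw [this, Submodule.Quotient.mk_eq_zero]
    exact Submodule.subset_span ⟨t, rfl⟩
  let ι : ∀ {M : Type u} [AddCommGroup M] [Module A M], N ⊗[ℤ] M →ₗ[ℤ] BalancedTensor A N M :=
    fun {M} _ _ => (balancedRelations A N M).mkQ
  have hbal : ∀ (n : N) (r : A) (x : M₃),
      ι (n ⊗ₜ[ℤ] (r • x)) = ι ((MulOpposite.op r • n) ⊗ₜ[ℤ] x) := fun n r x => by
    have hmem : (MulOpposite.op r • n) ⊗ₜ[ℤ] x - n ⊗ₜ[ℤ] (r • x) ∈ balancedRelations A N M₃ :=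
      Submodule.subset_span ⟨n, r, x, rfl⟩
    exact ((Submodule.Quotient.eq _).2 hmem).symm
  obtain ⟨z, hz⟩ := hex N (∑ s, ι (e s ⊗ₜ[ℤ] m s)) (by
    rw [map_sum]
    calc ∑ s, BalancedTensor.map A N g (ι (e s ⊗ₜ[ℤ] m s))
        = ∑ s, ι (e s ⊗ₜ[ℤ] g (m s)) := rfl
      _ = ∑ s, ∑ t, ι ((MulOpposite.op (a s t) • e s) ⊗ₜ[ℤ] v t) := by
          simp only [hm, TensorProduct.tmul_sum, map_sum, hbal]
      _ = 0 := by
          rw [Finset.sum_comm]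
          simp only [← map_sum, ← TensorProduct.sum_tmul, he, TensorProduct.zero_tmul, map_zero,
            Finset.sum_const_zero])
  obtain ⟨η, hη⟩ := exists_cokernelTensorMap_map a f z
  have h1 : cokernelTensorMap a M₂ (∑ s, ι (e s ⊗ₜ[ℤ] m s)) = QuotientAddGroup.mk m := by
    rw [map_sum]
    change ∑ s, QuotientAddGroup.mk' (matrixImage a M₂)
      (fun s' => (Pi.single s 1 : σ → A) s' • m s) = QuotientAddGroup.mk' _ m
    rw [← map_sum]
    congr 1
    ext s
    simp [Finset.sum_apply, Pi.single_apply]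
  have h2 := hη.symm.trans ((congrArg _ hz).trans h1)
  have h3 : -(fun s => f (η s)) + m ∈ matrixImage a M₂ := QuotientAddGroup.eq.1 h2
  obtain ⟨y, hy⟩ := h3
  refine ⟨η, y, fun s => ?_⟩
  rw [← hy s]
  simp

end TensorExact

/-! ### The two finitistic dimension arguments -/

section Categorical

theorem WithBot.exists_nat_gt_of_lt_top {x : WithBot ℕ∞} (hx : x < ⊤) : ∃ D : ℕ, x < D := by
  induction x with
  | bot => exact ⟨0, WithBot.bot_lt_coe _⟩
  | coe x =>
    induction x with
    | top => exact absurd hx (lt_irrefl _)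
    | coe n =>
      refine ⟨n + 1, ?_⟩
      exact_mod_cast Nat.lt_succ_self n

variable {A : Type u} [Ring A] {P : CochainComplex (ModuleCat.{u} A) ℤ}

theorem CochainComplex.nonempty_homotopy_id_zero
    (h : ∀ n : ℤ, P.X (n + 1) →ₗ[A] P.X n)
    (hh : ∀ n x, h (n + 1) ((P.d (n + 1) (n + 1 + 1)).hom x) + (P.d n (n + 1)).hom (h n x) = x) :
    Nonempty (Homotopy (𝟙 P) 0) := by
  let H : ∀ i j : ℤ, P.X i ⟶ P.X j := fun i j =>
    if hij : j + 1 = i then (P.XIsoOfEq hij).inv ≫ ModuleCat.ofHom (h j) else 0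
  have hH : ∀ j, H (j + 1) j = ModuleCat.ofHom (h j) := fun j => by simp [H]
  refine ⟨⟨H, fun i j hij => dif_neg hij, fun i => ?_⟩⟩
  obtain ⟨n, rfl⟩ : ∃ n, i = n + 1 := ⟨i - 1, by ring⟩
  rw [dNext_eq H (show (ComplexShape.up ℤ).Rel (n + 1) (n + 1 + 1) from rfl),
    prevD_eq H (show (ComplexShape.up ℤ).Rel n (n + 1) from rfl), hH, hH]
  ext x
  simpa using (hh n x).symm

/-- The terms of a cochain complex in degrees at most `m`, as a chain complex. -/
def CochainComplex.leftTail {C : Type*} [Category C] [Preadditive C] (K : CochainComplex C ℤ)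
    (m : ℤ) : ChainComplex C ℕ where
  X i := K.X (m - i)
  d i j := K.d (m - i) (m - j)
  shape i j hij := K.shape _ _ fun h => hij (by
    simp only [ComplexShape.up_Rel] at h
    simp only [ComplexShape.down_Rel]
    omega)

theorem CochainComplex.leftTail_exactAt_iff {R : Type*} [Ring R]
    (K : CochainComplex (ModuleCat.{u} R) ℤ) (m : ℤ) (i : ℕ) :
    (K.leftTail m).ExactAt (i + 1) ↔ K.ExactAt (m - (i + 1 : ℕ)) := by
  rw [HomologicalComplex.exactAt_iff' _ (i + 2) (i + 1) i (by simp) (by simp),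
    HomologicalComplex.exactAt_iff' _ (m - (i + 2 : ℕ)) (m - (i + 1 : ℕ)) (m - i)
      (by simp; omega) (by simp; omega)]
  rfl

/-- The projective resolution of a cokernel given by a left tail of an acyclic complex of
projective modules. -/
noncomputable def CochainComplex.leftTailResolution
    (hproj : ∀ n : ℤ, Module.Projective A (P.X n)) (hac : P.Acyclic) (m : ℤ) :
    ProjectiveResolution (Limits.cokernel ((P.leftTail m).d 1 0)) where
  complex := P.leftTail m
  projective n := by
    have := hproj (m - n)
    exact (IsProjective.iff_projective (R := A) (P.X (m - n))).1 this
  π := (ChainComplex.toSingle₀Equiv _ _).symm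
    ⟨Limits.cokernel.π _, Limits.cokernel.condition _⟩
  quasiIso := ⟨fun n => by
    cases n with
    | zero =>
      rw [ChainComplex.quasiIsoAt₀_iff, ShortComplex.quasiIso_iff_of_zeros']
      · refine (ShortComplex.exact_and_epi_g_iff_of_iso ?_).2
          ⟨ShortComplex.exact_cokernel ((P.leftTail m).d 1 0),
            inferInstanceAs (Epi (Limits.cokernel.π _))⟩
        exact ShortComplex.isoMk (Iso.refl _) (Iso.refl _) (Iso.refl _)
          ((Category.id_comp _).trans (Category.comp_id _).symm)
          ((Category.id_comp _).trans (Category.comp_id _).symm)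
      · exact (P.leftTail m).shape 0 0 (by simp)
      all_goals rfl
    | succ n =>
      rw [quasiIsoAt_iff_exactAt']
      · exact (P.leftTail_exactAt_iff m n).2 (hac _)
      · apply ChainComplex.exactAt_succ_single_obj⟩

/-- The part of `P` in degrees at most `m` is a projective resolution of the cokernel, so tensoring
it computes Tor. -/
theorem isZero_ringTor_cokernel_iff (hproj : ∀ n : ℤ, Module.Projective A (P.X n))
    (hac : P.Acyclic) (N : ModuleCat.{u} Aᵐᵒᵖ) (m : ℤ) (i : ℕ) :
    Limits.IsZero (ringTor A (i + 1) N (Limits.cokernel ((P.leftTail m).d 1 0))) ↔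
      (((balancedTensorFunctor A N).mapHomologicalComplex _).obj P).ExactAt (m - (i + 1 : ℕ)) := by
  rw [← CochainComplex.leftTail_exactAt_iff, HomologicalComplex.exactAt_iff_isZero_homology]
  exact ((CochainComplex.leftTailResolution hproj hac m).isoLeftDerivedObj
    (balancedTensorFunctor A N) (i + 1)).isZero_iff

theorem acyclic_balancedTensor_of_bigFlatFinitisticDim_lt_top
    (hA : bigFlatFinitisticDim A < ⊤) (hproj : ∀ n : ℤ, Module.Projective A (P.X n))
    (hbdd : CochainComplex.plus (ModuleCat.{u} A) P) (hac : P.Acyclic)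
    (N : ModuleCat.{u} Aᵐᵒᵖ) :
    (((balancedTensorFunctor A N).mapHomologicalComplex (ComplexShape.up ℤ)).obj P).Acyclic := by
  obtain ⟨b, hb⟩ := hbdd
  let Z : ℤ → ModuleCat.{u} A := fun m => Limits.cokernel ((P.leftTail m).d 1 0)
  -- Tor of index `i` sits at degree `m - i` of `N ⊗ P`, which is zero once `m - i < b`.
  have hfin : ∀ m, flatDimension A (Z m) < ⊤ := by
    intro m
    refine lt_of_le_of_lt (sInf_le (a := (((m - b).toNat : ℕ) : WithBot ℕ∞)) ?_)
      (WithBot.coe_lt_coe.2 (ENat.natCast_lt_top _))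
    intro i hi N
    have hi' : (m - b).toNat < i := by exact_mod_cast hi
    obtain ⟨j, rfl⟩ : ∃ j, i = j + 1 := ⟨i - 1, by omega⟩
    refine (isZero_ringTor_cokernel_iff hproj hac N m j).2 ?_
    refine ShortComplex.exact_of_isZero_X₂ _ ?_
    exact Functor.map_isZero (balancedTensorFunctor A N) (P.isZero_of_isStrictlyGE b (m - (j + 1 : ℕ)) (by omega))
  have hle : ∀ n, flatDimension A (Z n) ≤ bigFlatFinitisticDim A := fun n => by
    rw [bigFlatFinitisticDim]
    exact le_sSup ⟨Z n, hfin n, rfl⟩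
  obtain ⟨D, hD⟩ := WithBot.exists_nat_gt_of_lt_top hA
  intro k
  -- Degree `k` is read as Tor of index `D + 1` of a cokernel `D + 1` steps to the right; the index
  -- must be positive, and `D` may be 0.
  have hlt : flatDimension A (Z (k + (D + 1 : ℕ))) < (D + 1 : ℕ) :=
    lt_of_le_of_lt (hle _) (lt_trans hD (by exact_mod_cast Nat.lt_succ_self D))
  obtain ⟨n, hn, hnD⟩ := sInf_lt_iff.1 hlt
  have := (isZero_ringTor_cokernel_iff hproj hac N _ D).1 (hn (D + 1) hnD N)
  rwa [add_sub_cancel_right] at this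

theorem nonempty_homotopy_of_bigFlatFinitisticDim_lt_top
    (hA : bigFlatFinitisticDim A < ⊤) (hproj : ∀ n : ℤ, Module.Projective A (P.X n))
    (hbdd : CochainComplex.plus (ModuleCat.{u} A) P) (hac : P.Acyclic) :
    Nonempty (Homotopy (𝟙 P) 0) := by
  obtain ⟨h, hh⟩ := exists_graded_contraction (M := fun n => P.X n)
    (δ := fun n => (P.d n (n + 1)).hom)
    (fun n x => by
      have := P.d_comp_d n (n + 1) (n + 1 + 1)
      exact LinearMap.congr_fun (congrArg ModuleCat.Hom.hom this) x)
    (fun n σ τ _ _ a m v hm => by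
      refine exists_matrix_solution_of_tensor_exact _ _ (fun N _ _ w hw => ?_) a m v hm
      have := acyclic_balancedTensor_of_bigFlatFinitisticDim_lt_top hA hproj hbdd hac
        (ModuleCat.of Aᵐᵒᵖ N) (n + 1)
      rw [HomologicalComplex.exactAt_iff' _ n (n + 1) (n + 1 + 1) (by simp) (by simp),
        ShortComplex.moduleCat_exact_iff] at this
      exact this w hw)
  exact CochainComplex.nonempty_homotopy_id_zero h hh

theorem nonempty_homotopy_of_bigProjectiveFinitisticDim_lt_top
    (hA : bigProjectiveFinitisticDim A < ⊤) (hproj : ∀ n : ℤ, Module.Projective A (P.X n))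
    (hbdd : CochainComplex.plus (ModuleCat.{u} A) P) (hac : P.Acyclic) :
    Nonempty (Homotopy (𝟙 P) 0) := by
  obtain ⟨b, hb⟩ := hbdd
  let δ : ∀ n, P.X n →ₗ[A] P.X (n + 1) := fun n => (P.d n (n + 1)).hom
  have hex : ∀ n x, δ (n + 1) x = 0 → ∃ y, δ n y = x := by
    intro n
    have := hac (n + 1)
    rwa [HomologicalComplex.exactAt_iff' _ n (n + 1) (n + 1 + 1) (by simp) (by simp),
      ShortComplex.moduleCat_exact_iff] at this
  have hδ : ∀ n x, δ (n + 1) (δ n x) = 0 := fun n x =>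
    LinearMap.congr_fun (congrArg ModuleCat.Hom.hom (P.d_comp_d n (n + 1) (n + 1 + 1))) x
  let q : ∀ n, P.X n →ₗ[A] LinearMap.ker (δ (n + 1)) := fun n => (δ n).codRestrict _ (hδ n)
  have hq : ∀ n, Function.Surjective (q n) := fun n ⟨x, hx⟩ => by
    obtain ⟨y, hy⟩ := hex n x hx
    exact ⟨y, Subtype.ext hy⟩
  let Z : ℤ → ModuleCat.{u} A := fun n => ModuleCat.of A (LinearMap.ker (δ n))
  let S : ℤ → ShortComplex (ModuleCat.{u} A) := fun n =>
    ShortComplex.mk (X₁ := Z n) (X₂ := P.X n) (X₃ := Z (n + 1))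
      (ModuleCat.ofHom (LinearMap.ker (δ n)).subtype) (ModuleCat.ofHom (q n)) (by
        ext x
        exact x.2)
  have hS : ∀ n, (S n).ShortExact := fun n => by
    refine ModuleCat.shortComplex_shortExact (S n) ?_ Subtype.val_injective (hq n)
    intro x
    constructor
    · intro hx
      exact ⟨⟨x, congrArg Subtype.val hx⟩, rfl⟩
    · rintro ⟨x, rfl⟩
      exact Subtype.ext x.2
  have hP : ∀ n, Projective (S n).X₂ := fun n =>
    (IsProjective.iff_projective (R := A) (P.X n)).1 (hproj n)
  have hzero : ∀ n < b, Limits.IsZero (Z n) := fun n hn => by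
    have := ModuleCat.subsingleton_of_isZero (P.isZero_of_isStrictlyGE b n hn)
    exact ModuleCat.isZero_of_subsingleton _
  -- The induction starts at `b - 1`, where the cocycles vanish; each step right raises the
  -- dimension by at most one.
  have hZ : ∀ k : ℕ, HasProjectiveDimensionLT (Z (b - 1 + k)) k := by
    intro k
    induction k with
    | zero => exact (hzero _ (by simp)).hasProjectiveDimensionLT_zero
    | succ k ih =>
      have := (hS (b - 1 + k)).hasProjectiveDimensionLT_X₃ k ih
        (hasProjectiveDimensionLT_of_ge _ 1 (k + 1) (by omega))
      rwa [Nat.cast_succ, ← add_assoc]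
  have hfin : ∀ n, projectiveDimension (Z n) < ⊤ := by
    intro n
    have hk : ∃ k : ℕ, HasProjectiveDimensionLT (Z n) k := by
      rcases lt_or_ge n b with hn | hn
      · exact ⟨0, (hzero n hn).hasProjectiveDimensionLT_zero⟩
      · obtain ⟨k, rfl⟩ : ∃ k : ℕ, n = b - 1 + k := ⟨(n - (b - 1)).toNat, by omega⟩
        exact ⟨k, hZ k⟩
    obtain ⟨k, hk⟩ := hk
    exact (projectiveDimension_lt_iff.2 hk).trans_le le_top
  have hle : ∀ n, projectiveDimension (Z n) ≤ bigProjectiveFinitisticDim A := fun n => by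
    rw [bigProjectiveFinitisticDim]
    exact le_sSup ⟨Z n, hfin n, rfl⟩
  obtain ⟨D, hD⟩ := WithBot.exists_nat_gt_of_lt_top hA
  have hD' : ∀ n, HasProjectiveDimensionLT (Z n) (D + 1) := fun n => by
    have : HasProjectiveDimensionLT (Z n) D :=
      projectiveDimension_lt_iff.1 (lt_of_le_of_lt (hle n) hD)
    exact hasProjectiveDimensionLT_of_ge _ D (D + 1) (by omega)
  -- Passing to a syzygy lowers the bound at `n` by means of the bound at `n + 1`, so the bound is
  -- kept uniform in `n`.
  have hdown : ∀ k : ℕ, (∀ n, HasProjectiveDimensionLT (Z n) (k + 1)) →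
      ∀ n, HasProjectiveDimensionLT (Z n) 1 := by
    intro k
    induction k with
    | zero => exact id
    | succ k ih =>
      exact fun h => ih fun n => (hS n).hasProjectiveDimensionLT_X₁ (k + 1)
        (hasProjectiveDimensionLT_of_ge _ 1 (k + 1) (by omega)) (h (n + 1))
  have hproj' : ∀ n, Module.Projective A (LinearMap.ker (δ n)) := fun n =>
    (IsProjective.iff_projective (R := A) (Z n)).2
      (projective_iff_hasProjectiveDimensionLT_one.2 (hdown D hD' n))
  have hsec : ∀ n, ∃ s : LinearMap.ker (δ (n + 1)) →ₗ[A] P.X n, ∀ z, δ n (s z) = z := fun n => by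
    obtain ⟨s, hs⟩ := Module.projective_lifting_property (q n) LinearMap.id (hq n)
    exact ⟨s, fun z => congrArg Subtype.val (LinearMap.congr_fun hs z)⟩
  choose s hs using hsec
  -- `r` projects onto the cocycles along the image of the section; the contraction lifts this
  -- projection through `s`.
  let r : ∀ n, P.X (n + 1) →ₗ[A] LinearMap.ker (δ (n + 1)) := fun n =>
    (LinearMap.id - s (n + 1) ∘ₗ q (n + 1)).codRestrict _ fun x => by
      rw [LinearMap.mem_ker]
      simp only [LinearMap.sub_apply, LinearMap.id_apply, LinearMap.comp_apply, map_sub, hs]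
      exact sub_self (δ (n + 1) x)
  refine CochainComplex.nonempty_homotopy_id_zero (fun n => s n ∘ₗ r n) fun n x => ?_
  have h1 : r (n + 1) (δ (n + 1) x) = q (n + 1) x := by
    have : q (n + 1 + 1) (δ (n + 1) x) = 0 := Subtype.ext (hδ _ _)
    refine Subtype.ext ?_
    change δ (n + 1) x - s (n + 1 + 1) (q (n + 1 + 1) (δ (n + 1) x)) = δ (n + 1) x
    rw [this, map_zero, sub_zero]
  have h2 : δ n (s n (r n x)) = x - s (n + 1) (q (n + 1) x) := hs n _
  change s (n + 1) (r (n + 1) (δ (n + 1) x)) + δ n (s n (r n x)) = x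
  rw [h1, h2, add_sub_cancel]

end Categorical

theorem mainTheorem8 (A : Type u) [Ring A]
    (hA : bigProjectiveFinitisticDim A < ⊤ ∨ bigFlatFinitisticDim A < ⊤)
    (P : CochainComplex (ModuleCat.{u} A) ℤ)
    (hproj : ∀ n : ℤ, Module.Projective A (P.X n))
    (hbdd : CochainComplex.plus (ModuleCat.{u} A) P)
    (hac : P.Acyclic) :
    Nonempty (Homotopy (𝟙 P) 0) := by
  rcases hA with hA | hA
  · exact nonempty_homotopy_of_bigProjectiveFinitisticDim_lt_top hA hproj hbdd hac
  · exact nonempty_homotopy_of_bigFlatFinitisticDim_lt_top hA hproj hbdd hac
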